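/- **Setting.** For integers $M\ge 0$ and reals $f_0,B,T$ let $\mathbf f=f_0+\frac BM[0,\dots,M-1]^T$, $\mathbf t=\frac TM[0,\dots,M-1]^T$. Let $\mathbf F_M\in\mathbb C^{M\times M}$ have entries $\frac1{\sqrt M}e^{-j2\pi f_kt_n}$, let $\mathbf F_M^{\cdot\beta}$ be its entrywise power, with entries $M^{-\beta/2}e^{-j2\pi\beta f_kt_n}$, and for $\tau\in\mathbb R$, $\alpha>0$ let $\mathbf\Gamma_M(\tau,\alpha)=\frac1\alpha\mathrm{diag}[e^{-j2\pi\mathbf f\tau}]$. Fix the lower band edge $f_L$, the bandwidth $B$, and a grid of $N=N_\tau M_\alpha$ points with delays $\bar\tau_l$ and scales $\bar\alpha_l=q_\alpha^{\bar\omega_l}$, where $\bar\tau_l,\bar\omega_l\in\mathbb R$ and $q_\alpha>0$. Let $\mathbf G\in\mathbb C^{M_{\rm d}\times M_{\rm d}}$ and $\mathbf G_{\rm p}\in\mathbb C^{M_{\rm p}\times M_{\rm p}}$ be the transmitter matrices of the data and preamble waveforms (arbitrary matrices) and let $\mathbf x_{\rm p}\in\mathbb C^{M_{\rm p}}$ be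 the pilot vector. The effective channel matrix of $\mathbf g\in\mathbb C^N$ is $$\mathbf H(\mathbf g)=\mathbf G^H\Big(\sum_{l}g_l\sqrt{\bar\alpha_l}\,\mathbf F_{M_{\rm d}}^H\mathbf\Gamma_l\mathbf F_{M_{\rm d}}^{\cdot 1/\bar\alpha_l}\Big)\mathbf G,\qquad \mathbf\Gamma_l=\mathbf\Gamma_{M_{\rm d}}(\bar\tau_l,\bar\alpha_l),$$ with $f_0=f_L$ and $T=T_s$ (data duration). The measurement matrix $\mathbf A\in\mathbb C^{M_{\rm p}\times N}$ has columns $\sqrt{\bar\alpha_l}\,\mathbf G_{\rm p}^H\mathbf F_{M_{\rm p}}^H\mathbf\Gamma_{{\rm p},l}\mathbf F_{M_{\rm p}}^{\cdot 1/\bar\alpha_l}\mathbf G_{\rm p}\mathbf x_{\rm p}$, where $\mathbf F_{M_{\rm p}}$ uses $f_0=f_L$ and $T=T_{\rm p}$ (preamble duration) and $\mathbf\Gamma_{{\rm p},l}=\mathbf\Gamma_{M_{\rm p}}(\bar\tau_l,\bar\alpha_l)$ uses $f_0=0$. **Model.** $\mathbf y_{\rm p}=\mathbf A\bar{\mathbf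 h}+\mathbf w_{\rm p}$, where $\bar{\mathbf h}\sim\mathcal{CN}(\mathbf 0,\mathbf P^{-1})$ with $\mathbf P=\mathrm{diag}[\boldsymbol\theta]$, all $\theta_l>0$, and $\mathbf w_{\rm p}\sim\mathcal{CN}(\mathbf 0,\sigma_{\rm p}^2\mathbf I)$ with $\sigma_{\rm p}>0$ are independent. In real coordinates put $\mathbf h_{\rm R}=[\Re\bar{\mathbf h};\Im\bar{\mathbf h}]$, $\mathbf y_{\rm R}=[\Re\mathbf y_{\rm p};\Im\mathbf y_{\rm p}]$, $\mathbf A_{\rm R}=\begin{bmatrix}\Re\mathbf A&-\Im\mathbf A\\ \Im\mathbf A&\Re\mathbf A\end{bmatrix}$, $\sigma_{\rm R}^2=\sigma_{\rm p}^2/2$, $\mathbf P_{\mathbf h_{\rm R}}=\mathrm{diag}[2\boldsymbol\theta;2\boldsymbol\theta]$, so that $\mathbf h_{\rm R}\sim\mathcal N(\mathbf 0,\mathbf P_{\mathbf h_{\rm R}}^{-1})$ and $\mathbf y_{\rm R}\mid\mathbf h_{\rm R}\sim\mathcal N(\mathbf A_{\rm R}\mathbf h_{\rm R},\sigma_{\rm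 R}^2\mathbf I)$. **Theorem.** Let $$\mathbf\Phi_{\mathbf h_{\rm R}}=\frac{\mathbf A_{\rm R}^T\mathbf A_{\rm R}}{\sigma_{\rm R}^2}+\mathbf P_{\mathbf h_{\rm R}}=\begin{bmatrix}\mathbf\Phi_{11}&\mathbf\Phi_{12}\\ \mathbf\Phi_{21}&\mathbf\Phi_{22}\end{bmatrix},\qquad \mathbf\Phi_{\bar{\mathbf h}}=\tfrac14(\mathbf\Phi_{11}+\mathbf\Phi_{22})+\tfrac j4(\mathbf\Phi_{21}-\mathbf\Phi_{12}),$$ with $N\times N$ blocks, and let $\mathbf U\in\mathbb C^{M_{\rm d}^2\times N}$ have columns $\mathbf u_l=\mathrm{vec}\big(\mathbf G^H\sqrt{\bar\alpha_l}\,\mathbf F_{M_{\rm d}}^H\mathbf\Gamma_l\mathbf F_{M_{\rm d}}^{\cdot1/\bar\alpha_l}\mathbf G\big)$. Then: 1. $\mathbf\Phi_{\mathbf h_{\rm R}}$ is the real Bayesian information matrix $\mathbb E\big[-\frac{\partial^2}{\partial\mathbf h_{\rm R}\partial\mathbf h_{\rm R}^T}\ln p(\mathbf y_{\rm R},\mathbf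 h_{\rm R})\big]$. 2. $\mathbf\Phi_{\bar{\mathbf h}}$ is the complex one, $\mathbb E\big[-\frac{\partial^2}{\partial\bar{\mathbf h}^*\partial\bar{\mathbf h}^T}\ln p(\mathbf y_{\rm p},\bar{\mathbf h})\big]$ (Wirtinger derivatives), and it is positive definite. 3. $\mathrm{vec}(\mathbf H(\mathbf g))=\mathbf U\mathbf g$ for all $\mathbf g\in\mathbb C^N$. 4. Let $\widehat{\mathbf H}=\widehat{\mathbf H}(\mathbf y_{\rm p})$ be any (measurable) estimator of $\mathbf H=\mathbf H(\bar{\mathbf h})$ whose entrywise errors have finite second moment. Its MSE matrix $\mathbf E_{\rm MSE}=\mathbb E\big[(\mathrm{vec}\,\mathbf H-\mathrm{vec}\,\widehat{\mathbf H})(\mathrm{vec}\,\mathbf H-\mathrm{vec}\,\widehat{\mathbf H})^H\big]$ satisfies, in the Loewner order, $$\mathbf E_{\rm MSE}\succeq\mathbf U\,\mathbf\Phi_{\bar{\mathbf h}}^{-1}\,\mathbf U^H.$$ -/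

import Mathlib

open MeasureTheory ProbabilityTheory
open scoped Matrix ComplexOrder

noncomputable section

/-! ### Delay-scale channel matrices -/

/-- Frequency samples `f₀ + (B / M) k`, `k = 0, …, M - 1`. -/
def freqSample (M : ℕ) (f₀ B : ℝ) (k : Fin M) : ℝ := f₀ + B / M * (k : ℕ)

/-- Time samples `(T / M) n`, `n = 0, …, M - 1`. -/
def timeSample (M : ℕ) (T : ℝ) (n : Fin M) : ℝ := T / M * (n : ℕ)

/-- The matrix `F_M = M^(-1/2) exp(-j 2π f tᵀ)`, the exponential taken entrywise. -/
def fourierMatrix (M : ℕ) (f₀ B T : ℝ) : Matrix (Fin M) (Fin M) ℂ :=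
  Matrix.of fun k n => ((1 / Real.sqrt M : ℝ) : ℂ) *
    Complex.exp (-(Complex.I * ((2 * Real.pi * freqSample M f₀ B k * timeSample M T n : ℝ) : ℂ)))

/-- The entrywise power `F_M^{· β}`: the modulus `M^(-1/2)` of every entry of `fourierMatrix` is
raised to the power `β` and its phase `-2π f t` is multiplied by `β` (no reduction modulo `2π`,
so that no branch of the logarithm has to be chosen). -/
def fourierMatrixPow (M : ℕ) (f₀ B T β : ℝ) : Matrix (Fin M) (Fin M) ℂ :=
  Matrix.of fun k n => (((1 / Real.sqrt M) ^ β : ℝ) : ℂ) *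
    Complex.exp
      (-(Complex.I * ((2 * Real.pi * freqSample M f₀ B k * timeSample M T n * β : ℝ) : ℂ)))

/-- The delay matrix `Γ = α⁻¹ diag[exp(-j 2π f τ)]`, with `f = f₀ + (B / M) [0, …, M - 1]`. -/
def delayMatrix (M : ℕ) (f₀ B τ α : ℝ) : Matrix (Fin M) (Fin M) ℂ :=
  ((1 / α : ℝ) : ℂ) • Matrix.diagonal fun k =>
    Complex.exp (-(Complex.I * ((2 * Real.pi * freqSample M f₀ B k * τ : ℝ) : ℂ)))

/-- The scale values `q ^ ω_l` of a log-scale grid. -/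
def scaleGrid {ι : Type*} (q : ℝ) (ω : ι → ℝ) (l : ι) : ℝ := q ^ ω l

/-- The time-domain contribution `√α Fᴴ Γ F^{· 1/α}` of a unit-gain path with delay `τ` and
scale `α` to the data channel. -/
def pathMatrix (M : ℕ) (fL B T τ α : ℝ) : Matrix (Fin M) (Fin M) ℂ :=
  ((Real.sqrt α : ℝ) : ℂ) •
    ((fourierMatrix M fL B T)ᴴ * delayMatrix M fL B τ α * fourierMatrixPow M fL B T (1 / α))

/-- The time-domain channel matrix `Hᵗ = ∑ₗ hₗ √αₗ Fᴴ Γₗ F^{· 1/αₗ}`. -/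
def timeChannel {ι : Type*} [Fintype ι] (M : ℕ) (fL B T : ℝ) (τ α : ι → ℝ) (h : ι → ℂ) :
    Matrix (Fin M) (Fin M) ℂ :=
  ∑ l, h l • pathMatrix M fL B T (τ l) (α l)

/-- The effective channel matrix `H = Gᴴ Hᵗ G`. -/
def effectiveChannel {ι : Type*} [Fintype ι] (M : ℕ) (fL B T : ℝ) (G : Matrix (Fin M) (Fin M) ℂ)
    (τ α : ι → ℝ) (h : ι → ℂ) : Matrix (Fin M) (Fin M) ℂ :=
  Gᴴ * timeChannel M fL B T τ α h * G

/-- The matrix `U` with columns `uₗ = vec(Gᴴ √αₗ Fᴴ Γₗ F^{· 1/αₗ} G)`. -/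
def channelJacobian {ι : Type*} (M : ℕ) (fL B T : ℝ) (G : Matrix (Fin M) (Fin M) ℂ)
    (τ α : ι → ℝ) : Matrix (Fin M × Fin M) ι ℂ :=
  Matrix.of fun ij l => (Gᴴ * pathMatrix M fL B T (τ l) (α l) * G).vec ij

/-- The measurement matrix with columns
`√αₗ G_pᴴ Fᴴ Γ_{p,l} F^{· 1/αₗ} G_p x_p`; the frequencies in `Γ_{p,l}` start from zero. -/
def measurementMatrix {ι : Type*} (M : ℕ) (fL B T : ℝ) (Gp : Matrix (Fin M) (Fin M) ℂ)
    (xp : Fin M → ℂ) (τ α : ι → ℝ) : Matrix (Fin M) ι ℂ :=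
  Matrix.of fun i l => (((Real.sqrt (α l) : ℝ) : ℂ) •
    ((Gpᴴ * (fourierMatrix M fL B T)ᴴ * delayMatrix M 0 B (τ l) (α l) *
      fourierMatrixPow M fL B T (1 / α l) * Gp) *ᵥ xp)) i

/-! ### Gaussian densities -/

/-- The density of the circularly symmetric complex Gaussian law `CN(m, S)` on `ℂⁿ`:
`π^(-n) (det S)⁻¹ exp(-(x - m)ᴴ S⁻¹ (x - m))`, for `S` positive definite. -/
def complexGaussianDensity {ι : Type*} [Fintype ι] [DecidableEq ι] (m : ι → ℂ) (S : Matrix ι ι ℂ)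
    (x : ι → ℂ) : ℝ :=
  (Real.pi ^ Fintype.card ι * S.det.re)⁻¹ *
    Real.exp (-(star (x - m) ⬝ᵥ (S⁻¹ *ᵥ (x - m))).re)

/-- The law `CN(m, S)` on `ℂⁿ`, for `S` positive definite. -/
def complexGaussian {ι : Type*} [Fintype ι] [DecidableEq ι] (m : ι → ℂ) (S : Matrix ι ι ℂ) :
    Measure (ι → ℂ) :=
  volume.withDensity fun x => ENNReal.ofReal (complexGaussianDensity m S x)

/-- The density of the real Gaussian law `N(m, S)` on `ℝⁿ`, for `S` positive definite. -/
def realGaussianDensity {ι : Type*} [Fintype ι] [DecidableEq ι] (m : ι → ℝ) (S : Matrix ι ι ℝ)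
    (x : ι → ℝ) : ℝ :=
  (Real.sqrt ((2 * Real.pi) ^ Fintype.card ι * S.det))⁻¹ *
    Real.exp (-((x - m) ⬝ᵥ (S⁻¹ *ᵥ (x - m))) / 2)

/-! ### Real form of the model -/

/-- The real vector `[Re x; Im x]`. -/
def realVec {ι : Type*} (x : ι → ℂ) : ι ⊕ ι → ℝ :=
  Sum.elim (fun i => (x i).re) (fun i => (x i).im)

/-- The real matrix `[[Re A, -Im A], [Im A, Re A]]`. -/
def realMatrix {m n : Type*} (A : Matrix m n ℂ) : Matrix (m ⊕ m) (n ⊕ n) ℝ :=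
  Matrix.fromBlocks (A.map Complex.re) (-(A.map Complex.im)) (A.map Complex.im) (A.map Complex.re)

/-- The real precision matrix `diag[2θ; 2θ]`. -/
def realPrecision {n : Type*} [DecidableEq n] (θ : n → ℝ) : Matrix (n ⊕ n) (n ⊕ n) ℝ :=
  Matrix.diagonal (Sum.elim (fun l => 2 * θ l) (fun l => 2 * θ l))

/-! ### Bayesian information -/

/-- The logarithm of the joint density `p(y, h) = p(y | h) p(h)` of the complex model:
`y | h ∼ CN(A h, σ² I)`, `h ∼ CN(0, diag(θ)⁻¹)`. -/
def logJoint {m n : Type*} [Fintype m] [DecidableEq m] [Fintype n] [DecidableEq n]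
    (A : Matrix m n ℂ) (σ : ℝ) (θ : n → ℝ) (y : m → ℂ) (h : n → ℂ) : ℝ :=
  Real.log
    (complexGaussianDensity (A *ᵥ h) (((σ ^ 2 : ℝ) : ℂ) • (1 : Matrix m m ℂ)) y *
      complexGaussianDensity 0 (Matrix.diagonal fun l => (θ l : ℂ))⁻¹ h)

/-- The logarithm of the joint density of the real model: `y_R | h_R ∼ N(A_R h_R, (σ²/2) I)`,
`h_R ∼ N(0, diag[2θ; 2θ]⁻¹)`. -/
def realLogJoint {m n : Type*} [Fintype m] [DecidableEq m] [Fintype n] [DecidableEq n]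
    (A : Matrix m n ℂ) (σ : ℝ) (θ : n → ℝ) (yR : m ⊕ m → ℝ) (hR : n ⊕ n → ℝ) : ℝ :=
  Real.log
    (realGaussianDensity (realMatrix A *ᵥ hR) ((σ ^ 2 / 2) • (1 : Matrix (m ⊕ m) (m ⊕ m) ℝ)) yR *
      realGaussianDensity 0 (realPrecision θ)⁻¹ hR)

/-- The partial derivative `∂f / ∂x_i` of a real function on `ℝⁿ`. -/
def partialDeriv {ι : Type*} [Fintype ι] [DecidableEq ι] (f : (ι → ℝ) → ℝ) (i : ι) (x : ι → ℝ) :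
    ℝ :=
  fderiv ℝ f x (Pi.single i 1)

/-- The Wirtinger derivative `∂f / ∂z_i = (∂f/∂x_i - j ∂f/∂y_i) / 2`, with `z = x + j y`. -/
def wirtingerDeriv {ι : Type*} [Fintype ι] [DecidableEq ι] (f : (ι → ℂ) → ℂ) (i : ι)
    (z : ι → ℂ) : ℂ :=
  (fderiv ℝ f z (Pi.single i 1) - Complex.I * fderiv ℝ f z (Pi.single i Complex.I)) / 2

/-- The conjugate Wirtinger derivative `∂f / ∂z_i^* = (∂f/∂x_i + j ∂f/∂y_i) / 2`. -/
def wirtingerDerivConj {ι : Type*} [Fintype ι] [DecidableEq ι] (f : (ι → ℂ) → ℂ) (i : ι)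
    (z : ι → ℂ) : ℂ :=
  (fderiv ℝ f z (Pi.single i 1) + Complex.I * fderiv ℝ f z (Pi.single i Complex.I)) / 2

/-- The real Bayesian information matrix `E[-∂² ln p(y_R, h_R) / ∂h_R ∂h_Rᵀ]` under the joint law
of `(y, h)`. -/
def realBIM {Ω m n : Type*} [MeasurableSpace Ω] [Fintype m] [DecidableEq m] [Fintype n]
    [DecidableEq n] (μ : Measure Ω) (A : Matrix m n ℂ) (σ : ℝ) (θ : n → ℝ)
    (y : Ω → m → ℂ) (h : Ω → n → ℂ) : Matrix (n ⊕ n) (n ⊕ n) ℝ :=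
  Matrix.of fun i j => ∫ ω, -partialDeriv
    (partialDeriv (realLogJoint A σ θ (realVec (y ω))) j) i (realVec (h ω)) ∂μ

/-- The complex Bayesian information matrix `E[-∂² ln p(y, h) / ∂h^* ∂hᵀ]` under the joint law of
`(y, h)`. -/
def complexBIM {Ω m n : Type*} [MeasurableSpace Ω] [Fintype m] [DecidableEq m] [Fintype n]
    [DecidableEq n] (μ : Measure Ω) (A : Matrix m n ℂ) (σ : ℝ) (θ : n → ℝ)
    (y : Ω → m → ℂ) (h : Ω → n → ℂ) : Matrix n n ℂ :=
  Matrix.of fun a b => ∫ ω, -wirtingerDerivConj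
    (wirtingerDeriv (fun h' => (logJoint A σ θ (y ω) h' : ℂ)) b) a (h ω) ∂μ

/-- `Φ_{h_R} = A_Rᵀ A_R / σ_R² + P_{h_R}`, with `σ_R² = σ² / 2`. -/
def realInfo {m n : Type*} [Fintype m] [DecidableEq n] (A : Matrix m n ℂ)
    (σ : ℝ) (θ : n → ℝ) : Matrix (n ⊕ n) (n ⊕ n) ℝ :=
  (σ ^ 2 / 2)⁻¹ • ((realMatrix A)ᵀ * realMatrix A) + realPrecision θ

/-- `Φ_h = ¼ ([Φ]_ℜℜ + [Φ]_ℑℑ) + (j/4) ([Φ]_ℜℑ - [Φ]_ℑℜ)` with `Φ = Φ_{h_R}`, where the blocks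
`ℜℜ`, `ℑℑ`, `ℜℑ`, `ℑℜ` are the top-left, bottom-right, bottom-left and top-right ones. -/
def complexInfo {m n : Type*} [Fintype m] [DecidableEq n] (A : Matrix m n ℂ)
    (σ : ℝ) (θ : n → ℝ) : Matrix n n ℂ :=
  (1 / 4 : ℂ) •
      ((realInfo A σ θ).toBlocks₁₁ + (realInfo A σ θ).toBlocks₂₂).map Complex.ofReal +
    (Complex.I / 4) •
      ((realInfo A σ θ).toBlocks₂₁ - (realInfo A σ θ).toBlocks₁₂).map Complex.ofReal

/-! ### Mean square error -/

/-- The matrix `E[e eᴴ]` of a random error vector `e`. -/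
def mseMatrix {Ω κ : Type*} [MeasurableSpace Ω] (μ : Measure Ω) (e : Ω → κ → ℂ) : Matrix κ κ ℂ :=
  Matrix.of fun i j => ∫ ω, e ω i * star (e ω j) ∂μ

end

/-! ### Gaussian densities with diagonal precision -/

section densities

variable {ι : Type*} [Fintype ι] [DecidableEq ι]

/-! The log joint density is a constant minus a quadratic form in the channel vector, so both
Hessians are constant and the expectations defining the information matrices are trivial. The
complex one is `Φ = σ⁻² Aᴴ A + diag θ` (`complexInfo_eq`), a positive semidefinite plus a positive
definite matrix.

For the bound, let `L = σ⁻² Φ⁻¹ Aᴴ` and `ε = h - L y`. The heart is that `ε` is orthogonal to every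
measurable function of `y`. This is proved by symmetry, without conditional expectations: reflecting
`h` in the posterior mean `L y` while keeping `y` fixed is a linear involution of the pairs `(h,
w)`. It preserves Lebesgue measure, since its determinant squares to one, and the joint density, by
completing the square (`posteriorReflection_quadratic`). It negates `ε` and fixes `φ(y)`, so the
expectation of `ε φ(y)*` equals its own negative (`integral_lmmse_error_mul_star_comp`).

Any estimation error of `U h` splits as `U ε + ψ(y)` with vanishing cross terms, so its MSE matrix
is `U E[ε εᴴ] Uᴴ` plus a positive semidefinite matrix. Finally `E[ε εᴴ] = Φ⁻¹` (`mseMatrix_lmmse`).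
The argument works for arbitrary `A` and `U`; the channel enters only through its linearity in the
gains. -/

/-- Brings the noise covariance to the inverse-diagonal form of the prior, so that one density
formula serves both. -/
lemma smul_one_eq_inv_diagonal {K : Type*} [Field K] (s : K) (hs : s ≠ 0) :
    s • (1 : Matrix ι ι K) = (Matrix.diagonal fun _ => s⁻¹)⁻¹ := by
  symm
  apply Matrix.inv_eq_left_inv
  rw [← Matrix.diagonal_one, ← Matrix.diagonal_smul, Matrix.diagonal_mul_diagonal]
  congr 1
  ext i
  simp [hs]

lemma inv_inv_diagonal {K : Type*} [Field K] (d : ι → K) (hd : ∀ i, d i ≠ 0) :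
    ((Matrix.diagonal d)⁻¹)⁻¹ = Matrix.diagonal d := by
  apply Matrix.nonsing_inv_nonsing_inv
  rw [Matrix.det_diagonal]
  exact (Finset.prod_ne_zero_iff.2 fun i _ => hd i).isUnit

lemma complexGaussianDensity_inv_diagonal (θ : ι → ℝ) (hθ : ∀ i, 0 < θ i) (m x : ι → ℂ) :
    complexGaussianDensity m (Matrix.diagonal fun i => (θ i : ℂ))⁻¹ x =
      ∏ i, (θ i / Real.pi * Real.exp (-(θ i * ‖x i - m i‖ ^ 2))) := by
  have hdet : ((Matrix.diagonal fun i => (θ i : ℂ))⁻¹).det.re = (∏ i, θ i)⁻¹ := by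
    rw [Matrix.det_nonsing_inv, Matrix.det_diagonal, Ring.inverse_eq_inv', ← Complex.ofReal_prod,
      ← Complex.ofReal_inv, Complex.ofReal_re]
  rw [complexGaussianDensity, hdet, inv_inv_diagonal _ fun i => by simpa using (hθ i).ne',
    Finset.prod_mul_distrib, ← Real.exp_sum, Finset.prod_div_distrib]
  congr 1
  · simp [div_eq_inv_mul, mul_comm]
  · congr 1
    rw [Finset.sum_neg_distrib]
    congr 1
    simp only [dotProduct, Matrix.mulVec_diagonal, Complex.re_sum]
    refine Finset.sum_congr rfl fun i _ => ?_
    rw [← Complex.normSq_eq_norm_sq, Complex.normSq_apply]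
    simp
    ring

lemma realGaussianDensity_inv_diagonal (p : ι → ℝ) (hp : ∀ i, 0 < p i) (m x : ι → ℝ) :
    realGaussianDensity m (Matrix.diagonal p)⁻¹ x =
      (Real.sqrt ((2 * Real.pi) ^ Fintype.card ι * (∏ i, p i)⁻¹))⁻¹ *
        Real.exp (-∑ i, p i * (x i - m i) ^ 2 / 2) := by
  have hdet : ((Matrix.diagonal p)⁻¹).det = (∏ i, p i)⁻¹ := by
    rw [Matrix.det_nonsing_inv, Matrix.det_diagonal, Ring.inverse_eq_inv']
  rw [realGaussianDensity, hdet, inv_inv_diagonal _ fun i => (hp i).ne', neg_div]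
  congr 3
  simp only [dotProduct, Matrix.mulVec_diagonal, Finset.sum_div]
  refine Finset.sum_congr rfl fun i _ => ?_
  simp
  ring

end densities

/-! ### Hessians of the log densities and the information matrices -/

section quadratic

variable {m n : Type*} [Fintype m] [DecidableEq n]

/-- The constant is the logarithm of the two normalising factors; it stays existential because
differentiation kills it. -/
lemma exists_realLogJoint_eq [DecidableEq m] [Fintype n] (A : Matrix m n ℂ) {σ : ℝ} (hσ : 0 < σ) {θ : n → ℝ}
    (hθ : ∀ l, 0 < θ l) : ∃ c : ℝ, ∀ y h, realLogJoint A σ θ y h =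
      c - (∑ i, (σ ^ 2 / 2)⁻¹ * (y i - (realMatrix A *ᵥ h) i) ^ 2 / 2) -
        ∑ l, (Sum.elim (fun l => 2 * θ l) (fun l => 2 * θ l) l : ℝ) * h l ^ 2 / 2 := by
  have hs : 0 < σ ^ 2 / 2 := by positivity
  have hp : ∀ l, (0 : ℝ) < Sum.elim (fun l => 2 * θ l) (fun l => 2 * θ l) l := by
    rintro (l | l) <;> simpa using hθ l
  refine ⟨Real.log ((Real.sqrt ((2 * Real.pi) ^ Fintype.card (m ⊕ m) *
    (∏ _i : m ⊕ m, (σ ^ 2 / 2)⁻¹)⁻¹))⁻¹ * (Real.sqrt ((2 * Real.pi) ^ Fintype.card (n ⊕ n) *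
    (∏ l, (Sum.elim (fun l => 2 * θ l) (fun l => 2 * θ l) l : ℝ))⁻¹))⁻¹), fun y h => ?_⟩
  rw [realLogJoint, smul_one_eq_inv_diagonal _ hs.ne', realPrecision,
    realGaussianDensity_inv_diagonal _ (fun _ => inv_pos.2 hs),
    realGaussianDensity_inv_diagonal _ hp, mul_mul_mul_comm, ← Real.exp_add, Real.log_mul _
    (Real.exp_pos _).ne', Real.log_exp, ← sub_eq_add_neg, ← add_sub_assoc, ← sub_eq_add_neg]
  · simp only [Pi.zero_apply, sub_zero]
  · have h1 : (0 : ℝ) < ∏ _i : m ⊕ m, (σ ^ 2 / 2)⁻¹ := Finset.prod_pos fun _ _ => inv_pos.2 hs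
    have h2 := Finset.prod_pos fun i (_ : i ∈ Finset.univ) => hp i
    positivity

lemma exists_logJoint_eq [DecidableEq m] [Fintype n] (A : Matrix m n ℂ) {σ : ℝ} (hσ : 0 < σ) {θ : n → ℝ}
    (hθ : ∀ l, 0 < θ l) : ∃ c : ℝ, ∀ y h, logJoint A σ θ y h =
      c - (∑ i, (σ ^ 2)⁻¹ * ‖y i - (A *ᵥ h) i‖ ^ 2) - ∑ l, θ l * ‖h l‖ ^ 2 := by
  have hs : 0 < σ ^ 2 := by positivity
  refine ⟨Real.log ((∏ _i : m, (σ ^ 2)⁻¹ / Real.pi) * ∏ l, θ l / Real.pi), fun y h => ?_⟩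
  rw [logJoint, smul_one_eq_inv_diagonal _ (by exact_mod_cast hs.ne')]
  simp only [← Complex.ofReal_inv]
  rw [complexGaussianDensity_inv_diagonal _ (fun _ => inv_pos.2 hs),
    complexGaussianDensity_inv_diagonal _ hθ, Finset.prod_mul_distrib, Finset.prod_mul_distrib,
    ← Real.exp_sum, ← Real.exp_sum, mul_mul_mul_comm, ← Real.exp_add, Real.log_mul _
    (Real.exp_pos _).ne', Real.log_exp, Finset.sum_neg_distrib, Finset.sum_neg_distrib,
    ← sub_eq_add_neg, ← add_sub_assoc, ← sub_eq_add_neg]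
  · simp only [Pi.zero_apply, sub_zero]
  · have h1 : (0 : ℝ) < ∏ _i : m, (σ ^ 2)⁻¹ / Real.pi := Finset.prod_pos fun _ _ => by positivity
    have h2 : (0 : ℝ) < ∏ i, θ i / Real.pi := Finset.prod_pos fun i _ => by
      have := hθ i
      positivity
    positivity

lemma partialDeriv_partialDeriv_quadratic [Fintype n] (c : ℝ) (B : Matrix m n ℝ) (y : m → ℝ) (a : ℝ)
    (p : n → ℝ) (i j : n) (x : n → ℝ) :
    partialDeriv (partialDeriv (fun x => c - (∑ k, a * (y k - (B *ᵥ x) k) ^ 2 / 2) -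
      ∑ l, p l * x l ^ 2 / 2) j) i x = -(a • (Bᵀ * B) + Matrix.diagonal p) i j := by
  have hB : ∀ k (x : n → ℝ), HasFDerivAt (fun x => (B *ᵥ x) k)
      (LinearMap.toContinuousLinearMap (LinearMap.proj (R := ℝ) (φ := fun _ => ℝ) k ∘ₗ B.mulVecLin)) x := fun k x =>
    (LinearMap.toContinuousLinearMap (LinearMap.proj (R := ℝ) (φ := fun _ => ℝ) k ∘ₗ B.mulVecLin)).hasFDerivAt
  have h1 : partialDeriv (fun x => c - (∑ k, a * (y k - (B *ᵥ x) k) ^ 2 / 2) -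
      ∑ l, p l * x l ^ 2 / 2) j = fun x => (∑ k, a * (y k - (B *ᵥ x) k) * B k j) - p j * x j := by
    ext x
    have := ((HasFDerivAt.fun_sum (u := Finset.univ) fun k _ =>
      ((((hB k x).const_sub (y k)).pow 2).const_mul a).mul_const (1 / 2 : ℝ)).const_sub c).sub
      (HasFDerivAt.fun_sum (u := Finset.univ) fun l _ =>
      ((((ContinuousLinearMap.proj (R := ℝ) (φ := fun _ : n => ℝ) l).hasFDerivAt (x := x)).pow
        2).const_mul (p l)).mul_const (1 / 2 : ℝ))
    rw [partialDeriv]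
    simp only [div_eq_mul_one_div (_ * _ : ℝ) (2 : ℝ)]
    erw [this.fderiv]
    simp [Pi.single_apply, Finset.sum_neg_distrib, mul_assoc]
    congr 1
    · exact Finset.sum_congr rfl fun k _ => by ring
    · ring
  rw [h1, partialDeriv]
  have := (HasFDerivAt.fun_sum (u := Finset.univ) fun k _ =>
      (((hB k x).const_sub (y k)).const_mul a).mul_const (B k j)).sub
      (((ContinuousLinearMap.proj (R := ℝ) (φ := fun _ : n => ℝ) j).hasFDerivAt
        (x := x)).const_mul (p j))
  erw [this.fderiv]
  simp [Pi.single_apply, Finset.sum_neg_distrib, Matrix.mul_apply]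
  have e : ∑ x, B x j * (a * B x i) = a * ∑ x, B x i * B x j := by
    rw [Finset.mul_sum]
    exact Finset.sum_congr rfl fun k _ => by ring
  rw [e, Matrix.diagonal_apply]
  by_cases hij : i = j
  · subst hij
    simp
    ring
  · simp [hij, Ne.symm hij]

/-- With `|u|² = u ū` and `u = y - A z`, the derivative in `z_b` acts only on `u`. What remains is
affine in the conjugate of `z`, and the conjugate derivative in `z_a` reads off its coefficient. -/
lemma wirtingerDerivConj_wirtingerDeriv_quadratic [Fintype n] (c : ℝ) (A : Matrix m n ℂ) (y : m → ℂ) (s : ℝ)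
    (p : n → ℝ) (a b : n) (z : n → ℂ) :
    wirtingerDerivConj (wirtingerDeriv (fun z => ((c - (∑ k, s * ‖y k - (A *ᵥ z) k‖ ^ 2) -
      ∑ l, p l * ‖z l‖ ^ 2 : ℝ) : ℂ)) b) a z =
      -((s : ℂ) • (Aᴴ * A) + Matrix.diagonal fun l => (p l : ℂ)) a b := by
  have hA : ∀ k (x : n → ℂ), HasFDerivAt (𝕜 := ℝ) (fun x => (A *ᵥ x) k)
      (LinearMap.toContinuousLinearMap ((LinearMap.proj k ∘ₗ A.mulVecLin).restrictScalars ℝ)) x :=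
    fun k x => (LinearMap.toContinuousLinearMap
      ((LinearMap.proj k ∘ₗ A.mulVecLin).restrictScalars ℝ)).hasFDerivAt
  have hconj : ∀ {f : (n → ℂ) → ℂ} {f' : (n → ℂ) →L[ℝ] ℂ} {x : n → ℂ}, HasFDerivAt f f' x →
      HasFDerivAt (fun x => (starRingEnd ℂ) (f x)) (Complex.conjCLE.toContinuousLinearMap ∘L f') x :=
    fun hf => Complex.conjCLE.toContinuousLinearMap.hasFDerivAt.comp _ hf
  have hp : ∀ l (x : n → ℂ), HasFDerivAt (fun x : n → ℂ => x l)
      (ContinuousLinearMap.proj (R := ℝ) (φ := fun _ : n => ℂ) l) x := fun l x =>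
    (ContinuousLinearMap.proj (R := ℝ) (φ := fun _ : n => ℂ) l).hasFDerivAt
  have h0 : (fun z : n → ℂ => ((c - (∑ k, s * ‖y k - (A *ᵥ z) k‖ ^ 2) -
      ∑ l, p l * ‖z l‖ ^ 2 : ℝ) : ℂ)) = fun z => (c : ℂ) -
      (∑ k, (s : ℂ) * ((y k - (A *ᵥ z) k) * (starRingEnd ℂ) (y k - (A *ᵥ z) k))) -
      ∑ l, (p l : ℂ) * (z l * (starRingEnd ℂ) (z l)) := by
    ext z
    simp only [Complex.mul_conj']
    push_cast
    rfl
  have h1 : wirtingerDeriv (fun z => ((c - (∑ k, s * ‖y k - (A *ᵥ z) k‖ ^ 2) -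
      ∑ l, p l * ‖z l‖ ^ 2 : ℝ) : ℂ)) b = fun z =>
      (∑ k, (s : ℂ) * A k b * (starRingEnd ℂ) (y k - (A *ᵥ z) k)) -
        p b * (starRingEnd ℂ) (z b) := by
    ext z
    have hd := ((HasFDerivAt.fun_sum (u := Finset.univ) fun k _ =>
      ((((hA k z).const_sub (y k)).mul (hconj ((hA k z).const_sub (y k))))).const_mul
        (s : ℂ)).const_sub (c : ℂ)).sub
      (HasFDerivAt.fun_sum (u := Finset.univ) fun l _ =>
      ((hp l z).mul (hconj (hp l z))).const_mul (p l : ℂ))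
    rw [h0, wirtingerDeriv]
    erw [hd.fderiv]
    simp [Pi.single_apply, mul_assoc]
    have e1 : ∑ x, (s : ℂ) * ((y x - (A *ᵥ z) x) * ((starRingEnd ℂ) (A x b) * Complex.I)) =
        (∑ x, (s : ℂ) * ((y x - (A *ᵥ z) x) * (starRingEnd ℂ) (A x b))) * Complex.I := by
      rw [Finset.sum_mul]
      exact Finset.sum_congr rfl fun k _ => by ring
    have e2 : ∑ x, (s : ℂ) * (((starRingEnd ℂ) (y x) - (starRingEnd ℂ) ((A *ᵥ z) x)) *
        (A x b * Complex.I)) = (∑ x, (s : ℂ) *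
          (A x b * ((starRingEnd ℂ) (y x) - (starRingEnd ℂ) ((A *ᵥ z) x)))) * Complex.I := by
      rw [Finset.sum_mul]
      exact Finset.sum_congr rfl fun k _ => by ring
    have e3 : ∑ x, (s : ℂ) * (((starRingEnd ℂ) (y x) - (starRingEnd ℂ) ((A *ᵥ z) x)) * A x b) =
        ∑ x, (s : ℂ) * (A x b * ((starRingEnd ℂ) (y x) - (starRingEnd ℂ) ((A *ᵥ z) x))) :=
      Finset.sum_congr rfl fun k _ => by ring
    simp only [Finset.sum_add_distrib, Finset.sum_neg_distrib, e1, e2, e3,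
      apply_ite (starRingEnd ℂ), map_zero, mul_ite, mul_zero, Complex.conj_I, Finset.sum_ite_eq',
      Finset.mem_univ, if_true]
    ring_nf
    simp only [Complex.I_sq]
    ring
  rw [h1, wirtingerDerivConj]
  have hd := (HasFDerivAt.fun_sum (u := Finset.univ) fun k _ =>
      (hconj ((hA k z).const_sub (y k))).const_mul ((s : ℂ) * A k b)).sub
      ((hconj (hp b z)).const_mul (p b : ℂ))
  erw [hd.fderiv]
  simp [Pi.single_apply, Finset.sum_neg_distrib, mul_assoc, Matrix.mul_apply]
  have e1 : ∑ x, (s : ℂ) * (A x b * (starRingEnd ℂ) (A x a)) =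
      s * ∑ x, (starRingEnd ℂ) (A x a) * A x b := by
    rw [Finset.mul_sum]
    exact Finset.sum_congr rfl fun k _ => by ring
  have e2 : ∑ x, (s : ℂ) * (A x b * ((starRingEnd ℂ) (A x a) * Complex.I)) =
      (s * ∑ x, (starRingEnd ℂ) (A x a) * A x b) * Complex.I := by
    rw [Finset.mul_sum, Finset.sum_mul]
    exact Finset.sum_congr rfl fun k _ => by ring
  rw [e1, e2, Matrix.diagonal_apply]
  by_cases hab : a = b
  · subst hab
    simp only [if_true, Complex.conj_I]
    ring_nf
    simp only [Complex.I_sq]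
    ring
  · simp only [hab, Ne.symm hab, if_false, map_zero, mul_zero]
    ring_nf
    simp only [Complex.I_sq]
    ring

/-- Both diagonal blocks of `A_Rᵀ A_R` are `Re (Aᴴ A)`, and the off-diagonal ones are `± Im (Aᴴ A)`.
Each pair contributes a factor 2 and `σ_R² = σ² / 2` another, which the `1/4` cancels; the prior
likewise adds `2θ + 2θ`. -/
lemma complexInfo_eq (A : Matrix m n ℂ) (σ : ℝ) (θ : n → ℝ) : complexInfo A σ θ =
    (((σ ^ 2)⁻¹ : ℝ) : ℂ) • (Aᴴ * A) + Matrix.diagonal fun l => (θ l : ℂ) := by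
  ext a b
  simp only [complexInfo, realInfo, realMatrix, realPrecision, Matrix.toBlocks₁₁,
    Matrix.toBlocks₁₂, Matrix.toBlocks₂₁, Matrix.toBlocks₂₂, Matrix.add_apply, Matrix.smul_apply,
    Matrix.map_apply, Matrix.of_apply, Matrix.sub_apply, Matrix.mul_apply, Matrix.transpose_apply,
    Fintype.sum_sum_type, Matrix.fromBlocks_apply₁₁, Matrix.fromBlocks_apply₁₂,
    Matrix.fromBlocks_apply₂₁, Matrix.fromBlocks_apply₂₂, Matrix.neg_apply, smul_eq_mul,
    Matrix.conjTranspose_apply, Matrix.diagonal_apply, Sum.elim_inl, Sum.elim_inr, Sum.inl.injEq,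
    Sum.inr.injEq, reduceCtorEq, if_false]
  have : ∀ k, star (A k a) * A k b =
      (((A k a).re * (A k b).re + (A k a).im * (A k b).im : ℝ) : ℂ) +
      Complex.I * (((A k a).re * (A k b).im - (A k a).im * (A k b).re : ℝ) : ℂ) := fun k => by
    apply Complex.ext
    · simp
    · simp
      ring
  simp only [this, Finset.sum_add_distrib, ← Finset.mul_sum, ← Complex.ofReal_sum,
    Finset.sum_sub_distrib, mul_neg, neg_mul, Finset.sum_neg_distrib]
  by_cases hab : a = b <;> (simp only [hab]; simp; ring)

lemma realBIM_eq [DecidableEq m] [Fintype n] {Ω : Type*} [MeasurableSpace Ω] (μ : Measure Ω) [IsProbabilityMeasure μ]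
    (A : Matrix m n ℂ) {σ : ℝ} (hσ : 0 < σ) {θ : n → ℝ} (hθ : ∀ l, 0 < θ l)
    (y : Ω → m → ℂ) (h : Ω → n → ℂ) : realBIM μ A σ θ y h = realInfo A σ θ := by
  obtain ⟨c, hc⟩ := exists_realLogJoint_eq A hσ hθ
  ext i j
  simp only [realBIM, Matrix.of_apply, funext (hc _), partialDeriv_partialDeriv_quadratic]
  simp [realInfo, realPrecision]

lemma complexBIM_eq [DecidableEq m] [Fintype n] {Ω : Type*} [MeasurableSpace Ω] (μ : Measure Ω) [IsProbabilityMeasure μ]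
    (A : Matrix m n ℂ) {σ : ℝ} (hσ : 0 < σ) {θ : n → ℝ} (hθ : ∀ l, 0 < θ l)
    (y : Ω → m → ℂ) (h : Ω → n → ℂ) : complexBIM μ A σ θ y h = complexInfo A σ θ := by
  obtain ⟨c, hc⟩ := exists_logJoint_eq A hσ hθ
  ext i j
  simp only [complexBIM, Matrix.of_apply, hc, wirtingerDerivConj_wirtingerDeriv_quadratic]
  simp [complexInfo_eq]

lemma complexInfo_posDef [Fintype n] (A : Matrix m n ℂ) (σ : ℝ) {θ : n → ℝ} (hθ : ∀ l, 0 < θ l) :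
    (complexInfo A σ θ).PosDef := by
  rw [complexInfo_eq]
  refine Matrix.PosDef.posSemidef_add ?_ (Matrix.PosDef.diagonal fun l => by simpa using hθ l)
  refine (Matrix.posSemidef_conjTranspose_mul_self A).smul ?_
  exact_mod_cast (by positivity : (0 : ℝ) ≤ (σ ^ 2)⁻¹)

end quadratic

/-! ### Linear involutions preserve invariant densities -/

section invariance

/-- An involution has determinant `±1`, hence preserves Haar measure, and the density is invariant
by hypothesis. -/
lemma measurePreserving_withDensity_of_involutive {E : Type*} [NormedAddCommGroup E]
    [NormedSpace ℝ E] [MeasurableSpace E] [BorelSpace E] [FiniteDimensional ℝ E] (μ : Measure E)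
    [μ.IsAddHaarMeasure] (R : E →ₗ[ℝ] E) (hR : Function.Involutive R) {f : E → ENNReal}
    (hf : Measurable f) (hfR : ∀ x, f (R x) = f x) :
    MeasurePreserving R (μ.withDensity f) (μ.withDensity f) := by
  have hRm : Measurable R := R.continuous_of_finiteDimensional.measurable
  have hdet : LinearMap.det R * LinearMap.det R = 1 := by
    rw [← LinearMap.det_comp, show R ∘ₗ R = LinearMap.id from LinearMap.ext hR, LinearMap.det_id]
  have hμ : MeasurePreserving R μ μ := by
    refine ⟨hRm, ?_⟩
    rw [Measure.map_linearMap_addHaar_eq_smul_addHaar μ (left_ne_zero_of_mul_eq_one hdet)]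
    rcases mul_self_eq_one_iff.1 hdet with h | h <;> simp [h]
  refine ⟨hRm, ?_⟩
  ext s hs
  rw [Measure.map_apply hRm hs, withDensity_apply _ (hRm hs), withDensity_apply _ hs,
    ← hμ.setLIntegral_comp_preimage hs hf]
  simp only [hfR]

end invariance

/-! ### Symmetries and second moments of the Gaussian law -/

section gaussian

variable {m n : Type*} [Fintype m] [DecidableEq m] [Fintype n] [DecidableEq n]

/-- By independence the joint density depends on `(h, w)` only through the total weighted energy, so
any volume-preserving linear map that keeps this energy preserves the law. -/
lemma exists_map_prodMk_eq_withDensity {Ω : Type*} [MeasurableSpace Ω] {μ : Measure Ω}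
    [IsProbabilityMeasure μ] {h : Ω → n → ℂ} {w : Ω → m → ℂ} {p : n → ℝ} {r : m → ℝ}
    (hp : ∀ l, 0 < p l) (hr : ∀ i, 0 < r i)
    (hh : HasLaw h (complexGaussian 0 (Matrix.diagonal fun l => (p l : ℂ))⁻¹) μ)
    (hw : HasLaw w (complexGaussian 0 (Matrix.diagonal fun i => (r i : ℂ))⁻¹) μ)
    (hindep : IndepFun h w μ) :
    ∃ g : ℝ → ENNReal, Measurable g ∧ μ.map (fun ω => (h ω, w ω)) = volume.withDensity fun x =>
      g ((∑ l, p l * ‖x.1 l‖ ^ 2) + ∑ i, r i * ‖x.2 i‖ ^ 2) := by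
  refine ⟨fun q => ENNReal.ofReal ((∏ l, p l / Real.pi) * (∏ i, r i / Real.pi) * Real.exp (-q)),
    by fun_prop, ?_⟩
  rw [hindep.map_prod_eq_prod_map_map hh.aemeasurable hw.aemeasurable, hh.map_eq, hw.map_eq,
    complexGaussian, complexGaussian]
  simp only [complexGaussianDensity_inv_diagonal _ hp, complexGaussianDensity_inv_diagonal _ hr]
  rw [prod_withDensity (by fun_prop) (by fun_prop), Measure.volume_eq_prod]
  congr 1
  ext x
  rw [← ENNReal.ofReal_mul]
  · congr 1
    rw [Finset.prod_mul_distrib, Finset.prod_mul_distrib, ← Real.exp_sum, ← Real.exp_sum,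
      mul_mul_mul_comm, ← Real.exp_add]
    simp [Finset.sum_neg_distrib, add_comm]
  · refine Finset.prod_nonneg fun l _ => ?_
    have := hp l
    positivity

/-- Invariance of the law gives `E F = E (F ∘ R) = -E F`. No integrability is needed: the change of
variables holds for the Bochner integral with its default value 0. -/
lemma integral_eq_zero_of_odd_involutive {Ω : Type*} [MeasurableSpace Ω] {μ : Measure Ω}
    [IsProbabilityMeasure μ] {h : Ω → n → ℂ} {w : Ω → m → ℂ} {p : n → ℝ} {r : m → ℝ}
    (hp : ∀ l, 0 < p l) (hr : ∀ i, 0 < r i)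
    (hh : HasLaw h (complexGaussian 0 (Matrix.diagonal fun l => (p l : ℂ))⁻¹) μ)
    (hw : HasLaw w (complexGaussian 0 (Matrix.diagonal fun i => (r i : ℂ))⁻¹) μ)
    (hindep : IndepFun h w μ) (R : ((n → ℂ) × (m → ℂ)) →ₗ[ℝ] ((n → ℂ) × (m → ℂ)))
    (hR : Function.Involutive R)
    (hQ : ∀ x, (∑ l, p l * ‖(R x).1 l‖ ^ 2) + ∑ i, r i * ‖(R x).2 i‖ ^ 2 =
      (∑ l, p l * ‖x.1 l‖ ^ 2) + ∑ i, r i * ‖x.2 i‖ ^ 2)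
    {F : (n → ℂ) × (m → ℂ) → ℂ} (hF : Measurable F) (hodd : ∀ x, F (R x) = -F x) :
    ∫ ω, F (h ω, w ω) ∂μ = 0 := by
  obtain ⟨g, hg, hmap⟩ := exists_map_prodMk_eq_withDensity hp hr hh hw hindep
  have : (volume : Measure ((n → ℂ) × (m → ℂ))).IsAddHaarMeasure := by
    rw [Measure.volume_eq_prod]
    exact Measure.prod.instIsAddHaarMeasure _ _
  have hmp := measurePreserving_withDensity_of_involutive
    (volume : Measure ((n → ℂ) × (m → ℂ))) R hR
    (f := fun x => g ((∑ l, p l * ‖x.1 l‖ ^ 2) + ∑ i, r i * ‖x.2 i‖ ^ 2))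
    (hg.comp (by fun_prop)) (fun x => by rw [hQ])
  rw [← hmap] at hmp
  have key : ∫ x, F x ∂(μ.map fun ω => (h ω, w ω)) = -∫ x, F x ∂(μ.map fun ω => (h ω, w ω)) := by
    conv_lhs => rw [← hmp.map_eq]
    rw [integral_map hmp.measurable.aemeasurable hF.aestronglyMeasurable, ← integral_neg]
    simp only [hodd]
  rw [← integral_map (hh.aemeasurable.prodMk hw.aemeasurable) hF.aestronglyMeasurable]
  exact self_eq_neg.1 key

lemma integral_exp_neg_mul_normSq {b : ℝ} (hb : 0 < b) :
    ∫ z : ℂ, b / Real.pi * Real.exp (-(b * ‖z‖ ^ 2)) = 1 := by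
  have := Complex.integral_exp_neg_mul_rpow (p := 2) one_le_two hb
  simp only [Real.rpow_two, neg_mul] at this
  rw [integral_const_mul, this]
  have e : b ^ (-2 / 2 : ℝ) = b⁻¹ := by rw [← Real.rpow_neg_one]; norm_num
  rw [e]
  norm_num
  field_simp

lemma integral_exp_neg_mul_normSq_mul {b : ℝ} (hb : 0 < b) :
    ∫ z : ℂ, b / Real.pi * Real.exp (-(b * ‖z‖ ^ 2)) * ‖z‖ ^ 2 = b⁻¹ := by
  have := Complex.integral_rpow_mul_exp_neg_mul_rpow (p := 2) (q := 2) one_le_two (by norm_num) hb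
  simp only [Real.rpow_two, neg_mul] at this
  simp only [mul_assoc, mul_comm (Real.exp _)]
  rw [integral_const_mul, this]
  have e : b ^ (-(2 + 2) / 2 : ℝ) = (b ^ 2)⁻¹ := by
    rw [← Real.rpow_two, ← Real.rpow_neg hb.le]; norm_num
  rw [e]
  norm_num
  field_simp

lemma integrable_and_integral_normSq_complexGaussian {p : n → ℝ} (hp : ∀ l, 0 < p l) (a : n) :
    Integrable (fun x : n → ℂ => ‖x a‖ ^ 2)
      (complexGaussian 0 (Matrix.diagonal fun l => (p l : ℂ))⁻¹) ∧
    ∫ x : n → ℂ, ‖x a‖ ^ 2 ∂(complexGaussian 0 (Matrix.diagonal fun l => (p l : ℂ))⁻¹) =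
      (p a)⁻¹ := by
  have hdens : ∀ x : n → ℂ,
      0 ≤ ∏ l, (p l / Real.pi * Real.exp (-(p l * ‖x l‖ ^ 2))) := fun x =>
    Finset.prod_nonneg fun l _ => by have := hp l; positivity
  have hm : Measurable fun x : n → ℂ =>
      ENNReal.ofReal (∏ l, (p l / Real.pi * Real.exp (-(p l * ‖x l‖ ^ 2)))) := by fun_prop
  -- Absorbing `‖x a‖ ^ 2` into the factor of index `a` keeps the integrand a product, ready for
  -- Fubini.
  have hprod : ∀ x : n → ℂ,
      (∏ l, (p l / Real.pi * Real.exp (-(p l * ‖x l‖ ^ 2)))) * ‖x a‖ ^ 2 =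
        ∏ l, (p l / Real.pi * Real.exp (-(p l * ‖x l‖ ^ 2)) *
          if l = a then ‖x l‖ ^ 2 else 1) := fun x => by
    conv_rhs => rw [Finset.prod_mul_distrib]
    simp only [Finset.prod_ite_eq', Finset.mem_univ, if_true]
  have hint : ∀ l, ∫ z : ℂ, p l / Real.pi * Real.exp (-(p l * ‖z‖ ^ 2)) *
      (if l = a then ‖z‖ ^ 2 else 1) = if l = a then (p l)⁻¹ else 1 := fun l => by
    split_ifs
    · exact integral_exp_neg_mul_normSq_mul (hp l)
    · simpa using integral_exp_neg_mul_normSq (hp l)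
  rw [complexGaussian]
  simp only [complexGaussianDensity_inv_diagonal _ hp, Pi.zero_apply, sub_zero]
  constructor
  · rw [integrable_withDensity_iff hm (by simp)]
    simp only [ENNReal.toReal_ofReal (hdens _), mul_comm (‖_‖ ^ 2), hprod]
    refine Integrable.fintype_prod (f := fun l (z : ℂ) =>
      p l / Real.pi * Real.exp (-(p l * ‖z‖ ^ 2)) * if l = a then ‖z‖ ^ 2 else 1) fun l => ?_
    -- A non-integrable function would have integral 0, whereas these integrals equal `(p l)⁻¹` or
    -- 1.
    refine Integrable.of_integral_ne_zero ?_
    rw [hint]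
    split_ifs
    · exact (inv_pos.2 (hp l)).ne'
    · exact one_ne_zero
  · rw [integral_withDensity_eq_integral_toReal_smul hm (by simp)]
    simp only [ENNReal.toReal_ofReal (hdens _), smul_eq_mul, hprod]
    rw [integral_fintype_prod_volume_eq_prod (fun l (z : ℂ) =>
      p l / Real.pi * Real.exp (-(p l * ‖z‖ ^ 2)) * if l = a then ‖z‖ ^ 2 else 1)]
    simp only [hint]
    simp

lemma memLp_two_of_hasLaw_complexGaussian {Ω : Type*} [MeasurableSpace Ω] {μ : Measure Ω}
    {h : Ω → n → ℂ} {p : n → ℝ} (hp : ∀ l, 0 < p l)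
    (hh : HasLaw h (complexGaussian 0 (Matrix.diagonal fun l => (p l : ℂ))⁻¹) μ) (a : n) :
    MemLp (fun ω => h ω a) 2 μ := by
  have hm : AEStronglyMeasurable (fun ω => h ω a) μ :=
    ((measurable_pi_apply a).comp_aemeasurable hh.aemeasurable).aestronglyMeasurable
  rw [memLp_two_iff_integrable_sq_norm hm]
  have := (integrable_and_integral_normSq_complexGaussian hp a).1
  rw [← hh.map_eq] at this
  exact this.comp_aemeasurable hh.aemeasurable

lemma integral_mul_star_self_of_hasLaw_complexGaussian {Ω : Type*} [MeasurableSpace Ω]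
    {μ : Measure Ω} {h : Ω → n → ℂ} {p : n → ℝ} (hp : ∀ l, 0 < p l)
    (hh : HasLaw h (complexGaussian 0 (Matrix.diagonal fun l => (p l : ℂ))⁻¹) μ) (a : n) :
    ∫ ω, h ω a * star (h ω a) ∂μ = (p a : ℂ)⁻¹ := by
  have h1 := (integrable_and_integral_normSq_complexGaussian hp a).2
  have h2 : ∫ ω, ‖h ω a‖ ^ 2 ∂μ = (p a)⁻¹ := by
    rw [← h1, ← hh.map_eq, integral_map hh.aemeasurable]
    exact Measurable.aestronglyMeasurable (by fun_prop)
  have h3 : ∀ ω, h ω a * star (h ω a) = ((‖h ω a‖ ^ 2 : ℝ) : ℂ) := fun ω => by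
    rw [Complex.ofReal_pow]
    exact Complex.mul_conj' _
  simp only [h3]
  rw [integral_complex_ofReal, h2, Complex.ofReal_inv]

end gaussian

/-! ### Completing the square -/

section reflection

variable {m n : Type*} [Fintype m] [Fintype n]

lemma star_dotProduct_diagonal_mulVec [DecidableEq n] (p : n → ℝ) (h : n → ℂ) :
    star h ⬝ᵥ ((Matrix.diagonal fun l => (p l : ℂ)) *ᵥ h) = ((∑ l, p l * ‖h l‖ ^ 2 : ℝ) : ℂ) := by
  simp only [dotProduct, Matrix.mulVec_diagonal, Complex.ofReal_sum, Complex.ofReal_mul,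
    Complex.ofReal_pow, ← Complex.conj_mul', Pi.star_apply, starRingEnd_apply]
  exact Finset.sum_congr rfl fun l _ => by ring

lemma smul_star_dotProduct_self (s : ℝ) (h : n → ℂ) :
    (s : ℂ) * (star h ⬝ᵥ h) = ((∑ l, s * ‖h l‖ ^ 2 : ℝ) : ℂ) := by
  simp only [dotProduct, Complex.ofReal_sum, Complex.ofReal_mul, Finset.mul_sum,
    Complex.ofReal_pow, ← Complex.conj_mul', Pi.star_apply, starRingEnd_apply]

/-- A solution `c` of the normal equations is the centre of the quadratic in `h`: the terms linear
in `h` cancel, and the rest depends on `c` and `y` alone. Invertibility of the matrix is not needed.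
-/
lemma completing_square (A : Matrix m n ℂ) (s : ℝ) (D : Matrix n n ℂ) (hD : D.IsHermitian)
    (y : m → ℂ) (c : n → ℂ) (hc : ((s : ℂ) • (Aᴴ * A) + D) *ᵥ c = (s : ℂ) • (Aᴴ *ᵥ y))
    (h : n → ℂ) :
    star h ⬝ᵥ (D *ᵥ h) + s * (star (y - A *ᵥ h) ⬝ᵥ (y - A *ᵥ h)) =
      star (h - c) ⬝ᵥ (((s : ℂ) • (Aᴴ * A) + D) *ᵥ (h - c)) -
        star c ⬝ᵥ (((s : ℂ) • (Aᴴ * A) + D) *ᵥ c) + s * (star y ⬝ᵥ y) := by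
  have hΦ : ((s : ℂ) • (Aᴴ * A) + D).IsHermitian := by
    refine Matrix.IsHermitian.add ?_ hD
    rw [Matrix.IsHermitian, Matrix.conjTranspose_smul,
      (Matrix.isHermitian_conjTranspose_mul_self A).eq]
    simp
  have e1 : star c ⬝ᵥ (((s : ℂ) • (Aᴴ * A) + D) *ᵥ h) = s * (star y ⬝ᵥ (A *ᵥ h)) := by
    have := congrArg star hc
    rw [Matrix.star_mulVec, hΦ.eq, star_smul, Matrix.star_mulVec,
      Matrix.conjTranspose_conjTranspose] at this
    rw [Matrix.dotProduct_mulVec, this, smul_dotProduct, ← Matrix.dotProduct_mulVec]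
    simp
  have e2 : star (A *ᵥ h) ⬝ᵥ y = star h ⬝ᵥ (Aᴴ *ᵥ y) := by
    rw [Matrix.star_mulVec, ← Matrix.dotProduct_mulVec]
  have e3 : star (A *ᵥ h) ⬝ᵥ (A *ᵥ h) = star h ⬝ᵥ ((Aᴴ * A) *ᵥ h) := by
    rw [Matrix.star_mulVec, ← Matrix.dotProduct_mulVec, Matrix.mulVec_mulVec]
  simp only [star_sub, sub_dotProduct, dotProduct_sub, Matrix.mulVec_sub, e1, e2, e3, hc]
  simp only [Matrix.add_mulVec, dotProduct_add, Matrix.smul_mulVec, dotProduct_smul, smul_eq_mul]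
  ring

end reflection

/-! ### The linear estimator, the posterior reflection and MSE matrices -/

section mse

variable {m n : Type*} [Fintype m] [Fintype n]
  {Ω : Type*} [MeasurableSpace Ω] {μ : Measure Ω}

/-- The matrix `Φ⁻¹ Aᴴ / σ²` of the linear minimum mean square error estimator. -/
noncomputable def lmmse [DecidableEq n] (A : Matrix m n ℂ) (σ : ℝ) (θ : n → ℝ) : Matrix n m ℂ :=
  (((σ ^ 2)⁻¹ : ℝ) : ℂ) • ((complexInfo A σ θ)⁻¹ * Aᴴ)

lemma complexInfo_mulVec_lmmse [DecidableEq n] (A : Matrix m n ℂ) (σ : ℝ) {θ : n → ℝ} (hθ : ∀ l, 0 < θ l)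
    (y : m → ℂ) : complexInfo A σ θ *ᵥ (lmmse A σ θ *ᵥ y) =
      (((σ ^ 2)⁻¹ : ℝ) : ℂ) • (Aᴴ *ᵥ y) := by
  have hu := (Matrix.isUnit_iff_isUnit_det _).1 (complexInfo_posDef A σ hθ).isUnit
  rw [lmmse, Matrix.smul_mulVec, Matrix.mulVec_smul, Matrix.mulVec_mulVec,
    ← Matrix.mul_assoc, Matrix.mul_nonsing_inv _ hu, Matrix.one_mul]

/-- Multiply `Φ - σ⁻² Aᴴ A = diag θ` by `Φ⁻¹` on the left. This is the coefficient of `h` in the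
error `h - L y`. -/
lemma one_sub_lmmse_mul [DecidableEq n] (A : Matrix m n ℂ) (σ : ℝ) {θ : n → ℝ} (hθ : ∀ l, 0 < θ l) :
    1 - lmmse A σ θ * A = (complexInfo A σ θ)⁻¹ * Matrix.diagonal fun l => (θ l : ℂ) := by
  have hu := (Matrix.isUnit_iff_isUnit_det _).1 (complexInfo_posDef A σ hθ).isUnit
  have h2 := Matrix.nonsing_inv_mul _ hu
  conv at h2 => lhs; rhs; rw [complexInfo_eq]
  rw [lmmse, ← h2, mul_add, Matrix.smul_mul, Matrix.mul_smul, Matrix.mul_assoc]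
  abel

/-- The map `(h, w) ↦ (2 L y - h, y - A (2 L y - h))` with `y = A h + w`. -/
noncomputable def posteriorReflection (A : Matrix m n ℂ) (L : Matrix n m ℂ) :
    ((n → ℂ) × (m → ℂ)) →ₗ[ℝ] ((n → ℂ) × (m → ℂ)) where
  toFun x := ((2 : ℝ) • (L *ᵥ (A *ᵥ x.1 + x.2)) - x.1,
    (A *ᵥ x.1 + x.2) - A *ᵥ ((2 : ℝ) • (L *ᵥ (A *ᵥ x.1 + x.2)) - x.1))
  map_add' x x' := by
    ext <;> simp [Matrix.mulVec_add, Matrix.mulVec_sub, Matrix.mulVec_smul] <;> ring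
  map_smul' c x := by
    ext <;> simp [Matrix.mulVec_add, Matrix.mulVec_sub, Matrix.mulVec_smul] <;> ring

lemma posteriorReflection_observation (A : Matrix m n ℂ) (L : Matrix n m ℂ)
    (x : (n → ℂ) × (m → ℂ)) :
    A *ᵥ (posteriorReflection A L x).1 + (posteriorReflection A L x).2 = A *ᵥ x.1 + x.2 := by
  simp [posteriorReflection]

lemma posteriorReflection_fst (A : Matrix m n ℂ) (L : Matrix n m ℂ) (x : (n → ℂ) × (m → ℂ)) :
    (posteriorReflection A L x).1 = (2 : ℝ) • (L *ᵥ (A *ᵥ x.1 + x.2)) - x.1 := rfl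

lemma posteriorReflection_snd (A : Matrix m n ℂ) (L : Matrix n m ℂ) (x : (n → ℂ) × (m → ℂ)) :
    (posteriorReflection A L x).2 = (A *ᵥ x.1 + x.2) - A *ᵥ (posteriorReflection A L x).1 := rfl

lemma posteriorReflection_involutive (A : Matrix m n ℂ) (L : Matrix n m ℂ) :
    Function.Involutive (posteriorReflection A L) := by
  intro x
  have h1 : (posteriorReflection A L (posteriorReflection A L x)).1 = x.1 := by
    rw [posteriorReflection_fst, posteriorReflection_observation, posteriorReflection_fst]
    abel
  refine Prod.ext h1 ?_
  rw [posteriorReflection_snd, posteriorReflection_observation, h1]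
  abel

/-- Complete the square at `h` and at its reflection, with the same `y`: the two deviations from `L
y` are opposite, and the quadratic form is even. -/
lemma posteriorReflection_quadratic [DecidableEq n] (A : Matrix m n ℂ) (σ : ℝ) {θ : n → ℝ} (hθ : ∀ l, 0 < θ l)
    (x : (n → ℂ) × (m → ℂ)) :
    (∑ l, θ l * ‖(posteriorReflection A (lmmse A σ θ) x).1 l‖ ^ 2) +
      ∑ i, (σ ^ 2)⁻¹ * ‖(posteriorReflection A (lmmse A σ θ) x).2 i‖ ^ 2 =
    (∑ l, θ l * ‖x.1 l‖ ^ 2) + ∑ i, (σ ^ 2)⁻¹ * ‖x.2 i‖ ^ 2 := by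
  apply Complex.ofReal_injective
  rw [Complex.ofReal_add, Complex.ofReal_add, ← star_dotProduct_diagonal_mulVec θ,
    ← star_dotProduct_diagonal_mulVec θ, ← smul_star_dotProduct_self, ← smul_star_dotProduct_self]
  have hD : (Matrix.diagonal fun l => (θ l : ℂ)).IsHermitian :=
    (Matrix.PosDef.diagonal fun l => by simpa using hθ l).isHermitian
  have hc := complexInfo_mulVec_lmmse A σ hθ (A *ᵥ x.1 + x.2)
  rw [complexInfo_eq] at hc
  have key := completing_square A _ _ hD _ _ hc
  have h2 : x.2 = (A *ᵥ x.1 + x.2) - A *ᵥ x.1 := by abel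
  have h3 := key x.1
  rw [← h2] at h3
  rw [posteriorReflection_snd, key, h3, posteriorReflection_fst]
  have h4 : (2 : ℝ) • (lmmse A σ θ *ᵥ (A *ᵥ x.1 + x.2)) - x.1 - lmmse A σ θ *ᵥ (A *ᵥ x.1 + x.2) =
      -(x.1 - lmmse A σ θ *ᵥ (A *ᵥ x.1 + x.2)) := by
    rw [two_smul]
    abel
  rw [h4]
  simp only [star_neg, Matrix.mulVec_neg, neg_dotProduct, dotProduct_neg, neg_neg]

lemma integrable_mul_star {f g : Ω → ℂ} (hf : MemLp f 2 μ) (hg : MemLp g 2 μ) :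
    Integrable (fun ω => f ω * star (g ω)) μ :=
  hf.integrable_mul hg.star

/-- The quadratic form at `x` is the expectation of `|xᴴ e|²`. -/
lemma mseMatrix_posSemidef {κ : Type*} [Fintype κ] {e : Ω → κ → ℂ}
    (he : ∀ i, MemLp (fun ω => e ω i) 2 μ) : (mseMatrix μ e).PosSemidef := by
  have hint : ∀ i j, Integrable (fun ω => e ω i * star (e ω j)) μ :=
    fun i j => integrable_mul_star (he i) (he j)
  refine Matrix.PosSemidef.of_dotProduct_mulVec_nonneg ?_ fun x => ?_
  · ext i j
    simp only [mseMatrix, Matrix.conjTranspose_apply, Matrix.of_apply]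
    rw [← starRingEnd_apply, ← integral_conj]
    simp [mul_comm]
  · have h1 : star x ⬝ᵥ (mseMatrix μ e *ᵥ x) =
        ∫ ω, ((‖∑ i, star (x i) * e ω i‖ ^ 2 : ℝ) : ℂ) ∂μ := by
      have h2 : ∀ ω, ((‖∑ i, star (x i) * e ω i‖ ^ 2 : ℝ) : ℂ) =
          ∑ i, ∑ j, (star (x i) * x j) * (e ω i * star (e ω j)) := fun ω => by
        rw [Complex.ofReal_pow, ← Complex.mul_conj', map_sum, Finset.sum_mul_sum]
        refine Finset.sum_congr rfl fun i _ => Finset.sum_congr rfl fun j _ => ?_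
        simp
        ring
      simp only [h2]
      rw [integral_finsetSum _ fun i _ => integrable_finsetSum _ fun j _ =>
        (hint i j).const_mul _]
      simp only [dotProduct, Matrix.mulVec, Finset.mul_sum]
      refine Finset.sum_congr rfl fun i _ => ?_
      rw [integral_finsetSum _ fun j _ => (hint i j).const_mul _]
      refine Finset.sum_congr rfl fun j _ => ?_
      rw [integral_const_mul]
      simp only [mseMatrix, Matrix.of_apply, Pi.star_apply]
      ring
    rw [h1, integral_complex_ofReal]
    exact_mod_cast integral_nonneg fun ω => by positivity

lemma memLp_two_mulVec {κ : Type*} (M : Matrix κ n ℂ) {f : Ω → n → ℂ}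
    (hf : ∀ l, MemLp (fun ω => f ω l) 2 μ) (k : κ) : MemLp (fun ω => (M *ᵥ f ω) k) 2 μ :=
  memLp_finsetSum _ fun l _ => (hf l).const_mul (M k l)

lemma memLp_two_lmmse_error (A : Matrix m n ℂ) (L : Matrix n m ℂ) {h : Ω → n → ℂ} {w : Ω → m → ℂ}
    (hh : ∀ l, MemLp (fun ω => h ω l) 2 μ) (hw : ∀ i, MemLp (fun ω => w ω i) 2 μ) (a : n) :
    MemLp (fun ω => (h ω - L *ᵥ (A *ᵥ h ω + w ω)) a) 2 μ :=
  (hh a).sub (memLp_two_mulVec L (fun i => (memLp_two_mulVec A hh i).add (hw i)) a)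

/-- Pythagoras: one family of cross terms vanishes by hypothesis, the other is its conjugate. -/
lemma mseMatrix_add {κ : Type*} {e d : Ω → κ → ℂ} (he : ∀ k, MemLp (fun ω => e ω k) 2 μ)
    (hd : ∀ k, MemLp (fun ω => d ω k) 2 μ) (hed : ∀ k l, ∫ ω, e ω k * star (d ω l) ∂μ = 0) :
    mseMatrix μ (fun ω => e ω + d ω) = mseMatrix μ e + mseMatrix μ d := by
  have hde : ∀ k l, ∫ ω, d ω k * star (e ω l) ∂μ = 0 := fun k l => by
    have := congrArg (starRingEnd ℂ) (hed l k)
    rw [← integral_conj, map_zero] at this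
    rw [← this]
    simp [mul_comm]
  ext k l
  have h : ∀ ω, (e ω + d ω) k * star ((e ω + d ω) l) =
      (e ω k * star (e ω l) + e ω k * star (d ω l)) +
        (d ω k * star (e ω l) + d ω k * star (d ω l)) := fun ω => by
    rw [Pi.add_apply, Pi.add_apply, star_add]
    ring
  simp only [mseMatrix, Matrix.of_apply, Matrix.add_apply, h]
  rw [integral_add, integral_add, integral_add, hed, hde, add_zero, zero_add]
  · exact integrable_mul_star (hd k) (he l)
  · exact integrable_mul_star (hd k) (hd l)
  · exact integrable_mul_star (he k) (he l)
  · exact integrable_mul_star (he k) (hd l)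
  · exact (integrable_mul_star (he k) (he l)).add (integrable_mul_star (he k) (hd l))
  · exact (integrable_mul_star (hd k) (he l)).add (integrable_mul_star (hd k) (hd l))

lemma mseMatrix_mulVec {κ : Type*} (U : Matrix κ n ℂ) {e : Ω → n → ℂ}
    (he : ∀ a, MemLp (fun ω => e ω a) 2 μ) :
    mseMatrix μ (fun ω => U *ᵥ e ω) = U * mseMatrix μ e * Uᴴ := by
  ext k l
  have h : ∀ ω, (U *ᵥ e ω) k * star ((U *ᵥ e ω) l) =
      ∑ b, ∑ a, (U k a * star (U l b)) * (e ω a * star (e ω b)) := fun ω => by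
    rw [Matrix.mulVec, Matrix.mulVec, dotProduct, dotProduct, star_sum, Finset.sum_mul_sum,
      Finset.sum_comm]
    refine Finset.sum_congr rfl fun b _ => Finset.sum_congr rfl fun a _ => ?_
    rw [star_mul]
    ring
  have hi : ∀ a b, Integrable (fun ω => (U k a * star (U l b)) * (e ω a * star (e ω b))) μ :=
    fun a b => (integrable_mul_star (he a) (he b)).const_mul _
  rw [mseMatrix, Matrix.of_apply]
  simp only [h]
  rw [integral_finsetSum _ fun b _ => integrable_finsetSum _ fun a _ => hi a b, Matrix.mul_apply]
  refine Finset.sum_congr rfl fun b _ => ?_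
  rw [integral_finsetSum _ fun a _ => hi a b, Matrix.mul_apply, Finset.sum_mul]
  refine Finset.sum_congr rfl fun a _ => ?_
  rw [integral_const_mul, Matrix.conjTranspose_apply, mseMatrix, Matrix.of_apply]
  ring

/-! ### Orthogonality of the error and the bound -/

section model

variable [DecidableEq m] [DecidableEq n] [IsProbabilityMeasure μ] (A : Matrix m n ℂ) {σ : ℝ} (hσ : 0 < σ) {θ : n → ℝ}
  (hθ : ∀ l, 0 < θ l) {h : Ω → n → ℂ} {w : Ω → m → ℂ}
  (hh : HasLaw h (complexGaussian 0 (Matrix.diagonal fun l => (θ l : ℂ))⁻¹) μ)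
  (hw : HasLaw w
    (complexGaussian 0 (Matrix.diagonal fun _ : m => (((σ ^ 2)⁻¹ : ℝ) : ℂ))⁻¹) μ)
  (hindep : IndepFun h w μ)

include hσ hθ hh hw hindep

/-- The posterior reflection fixes `y` and negates `h - L y`, so the integrand is odd. -/
lemma integral_lmmse_error_mul_star_comp {φ : (m → ℂ) → ℂ} (hφ : Measurable φ) (a : n) :
    ∫ ω, (h ω - lmmse A σ θ *ᵥ (A *ᵥ h ω + w ω)) a * star (φ (A *ᵥ h ω + w ω)) ∂μ = 0 := by
  have hr : ∀ _ : m, 0 < (σ ^ 2)⁻¹ := fun _ => by positivity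
  have hA : Measurable fun x : (n → ℂ) × (m → ℂ) => A *ᵥ x.1 + x.2 :=
    Continuous.measurable (by fun_prop)
  have hL : Measurable fun x : (n → ℂ) × (m → ℂ) =>
      (x.1 - lmmse A σ θ *ᵥ (A *ᵥ x.1 + x.2)) a := Continuous.measurable (by fun_prop)
  refine integral_eq_zero_of_odd_involutive hθ hr hh hw hindep
    (posteriorReflection A (lmmse A σ θ)) (posteriorReflection_involutive _ _)
    (posteriorReflection_quadratic A σ hθ) (F := fun x =>
      (x.1 - lmmse A σ θ *ᵥ (A *ᵥ x.1 + x.2)) a * star (φ (A *ᵥ x.1 + x.2)))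
    (hL.mul (continuous_star.measurable.comp (hφ.comp hA))) fun x => ?_
  rw [posteriorReflection_observation, posteriorReflection_fst, ← neg_mul]
  congr 1
  simp only [Pi.sub_apply, Pi.add_apply, two_smul]
  ring

lemma integral_noise_mul_star_eq_zero (i : m) (a : n) : ∫ ω, w ω i * star (h ω a) ∂μ = 0 := by
  have hr : ∀ _ : m, 0 < (σ ^ 2)⁻¹ := fun _ => by positivity
  refine integral_eq_zero_of_odd_involutive hθ hr hh hw hindep
    (LinearMap.prodMap LinearMap.id (-LinearMap.id)) (fun x => by simp) (fun x => by simp)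
    (F := fun x => x.2 i * star (x.1 a)) (by fun_prop) fun x => by simp

/-- Symmetry under a sign flip of the single coordinate `a`. -/
lemma integral_mul_star_of_ne {a b : n} (hab : a ≠ b) : ∫ ω, h ω a * star (h ω b) ∂μ = 0 := by
  have hr : ∀ _ : m, 0 < (σ ^ 2)⁻¹ := fun _ => by positivity
  let S : (n → ℂ) →ₗ[ℝ] (n → ℂ) := LinearMap.pi fun l =>
    (if l = a then (-1 : ℝ) else 1) • (LinearMap.proj l : (n → ℂ) →ₗ[ℝ] ℂ)
  have hS : ∀ x l, S x l = (if l = a then (-1 : ℝ) else 1) • x l := fun x l => rfl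
  refine integral_eq_zero_of_odd_involutive hθ hr hh hw hindep
    (LinearMap.prodMap S LinearMap.id) (fun x => ?_) (fun x => ?_)
    (F := fun x => x.1 a * star (x.1 b)) (by fun_prop) fun x => ?_
  · refine Prod.ext (funext fun l => ?_) rfl
    simp only [LinearMap.prodMap_apply, hS, smul_smul]
    split_ifs <;> simp
  · congr 1
    refine Finset.sum_congr rfl fun l _ => ?_
    simp only [LinearMap.prodMap_apply, hS]
    split_ifs <;> simp
  · simp [hS, hab.symm]

/-- As `ε` is orthogonal to `L y`, `E[ε εᴴ] = E[ε hᴴ]`. With `ε = (1 - L A) h - L w` and `w`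
uncorrelated with `h`, this is `(1 - L A) (diag θ)⁻¹ = Φ⁻¹`. -/
lemma mseMatrix_lmmse :
    mseMatrix μ (fun ω => h ω - lmmse A σ θ *ᵥ (A *ᵥ h ω + w ω)) = (complexInfo A σ θ)⁻¹ := by
  ext a b
  rw [mseMatrix, Matrix.of_apply]
  have hhL := memLp_two_of_hasLaw_complexGaussian hθ hh
  have hwL := memLp_two_of_hasLaw_complexGaussian (fun _ => by positivity) hw
  have hεL := memLp_two_lmmse_error A (lmmse A σ θ) hhL hwL
  have hLy : ∀ b, MemLp (fun ω => (lmmse A σ θ *ᵥ (A *ᵥ h ω + w ω)) b) 2 μ :=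
    memLp_two_mulVec _ fun i => (memLp_two_mulVec A hhL i).add (hwL i)
  have h0 := integral_lmmse_error_mul_star_comp A hσ hθ hh hw hindep
    (φ := fun v => (lmmse A σ θ *ᵥ v) b) (Continuous.measurable (by fun_prop)) a
  have h1 : ∀ ω, (h ω - lmmse A σ θ *ᵥ (A *ᵥ h ω + w ω)) a *
      star ((h ω - lmmse A σ θ *ᵥ (A *ᵥ h ω + w ω)) b) =
      (h ω - lmmse A σ θ *ᵥ (A *ᵥ h ω + w ω)) a * star (h ω b) -
      (h ω - lmmse A σ θ *ᵥ (A *ᵥ h ω + w ω)) a *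
        star ((lmmse A σ θ *ᵥ (A *ᵥ h ω + w ω)) b) := fun ω => by
    rw [← mul_sub, ← star_sub]
    rfl
  have h2 : ∀ ω, (h ω - lmmse A σ θ *ᵥ (A *ᵥ h ω + w ω)) a * star (h ω b) =
      (∑ c, (1 - lmmse A σ θ * A : Matrix n n ℂ) a c * (h ω c * star (h ω b))) -
        ∑ i, lmmse A σ θ a i * (w ω i * star (h ω b)) := fun ω => by
    have : h ω - lmmse A σ θ *ᵥ (A *ᵥ h ω + w ω) =
        (1 - lmmse A σ θ * A) *ᵥ h ω - lmmse A σ θ *ᵥ w ω := by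
      rw [Matrix.mulVec_add, Matrix.mulVec_mulVec, Matrix.sub_mulVec, Matrix.one_mulVec]
      abel
    rw [this, Pi.sub_apply, sub_mul, Matrix.mulVec, Matrix.mulVec, dotProduct, dotProduct,
      Finset.sum_mul, Finset.sum_mul]
    simp only [mul_assoc]
  simp only [h1]
  rw [integral_sub (integrable_mul_star (hεL a) (hhL b)) (integrable_mul_star (hεL a) (hLy b)),
    h0, sub_zero]
  simp only [h2]
  have hi1 : ∀ c, Integrable (fun ω => (1 - lmmse A σ θ * A : Matrix n n ℂ) a c * (h ω c * star (h ω b))) μ :=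
    fun c => (integrable_mul_star (hhL c) (hhL b)).const_mul _
  have hi2 : ∀ i, Integrable (fun ω => lmmse A σ θ a i * (w ω i * star (h ω b))) μ :=
    fun i => (integrable_mul_star (hwL i) (hhL b)).const_mul _
  rw [integral_sub (integrable_finsetSum _ fun c _ => hi1 c)
    (integrable_finsetSum _ fun i _ => hi2 i), integral_finsetSum _ fun c _ => hi1 c,
    integral_finsetSum _ fun i _ => hi2 i]
  simp only [integral_const_mul, integral_noise_mul_star_eq_zero hσ hθ hh hw hindep, mul_zero,
    Finset.sum_const_zero, sub_zero]
  rw [Finset.sum_eq_single b (fun c _ hcb => by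
    rw [integral_mul_star_of_ne hσ hθ hh hw hindep hcb, mul_zero]) (by simp),
    integral_mul_star_self_of_hasLaw_complexGaussian hθ hh, one_sub_lmmse_mul A σ hθ,
    Matrix.mul_diagonal, mul_assoc, mul_inv_cancel₀ (by simpa using (hθ b).ne'), mul_one]

/-- The Bayesian Cramér-Rao bound for a linear function `U h` of a complex Gaussian vector `h`
observed through `A h + w`. -/
lemma mseMatrix_sub_posSemidef {κ : Type*} [Fintype κ] (U : Matrix κ n ℂ) {f : (m → ℂ) → κ → ℂ}
    (hf : ∀ k, Measurable fun v => f v k)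
    (he : ∀ k, MemLp (fun ω => (U *ᵥ h ω) k - f (A *ᵥ h ω + w ω) k) 2 μ) :
    (mseMatrix μ (fun ω => U *ᵥ h ω - f (A *ᵥ h ω + w ω)) -
      U * (complexInfo A σ θ)⁻¹ * Uᴴ).PosSemidef := by
  have hhL := memLp_two_of_hasLaw_complexGaussian hθ hh
  have hwL := memLp_two_of_hasLaw_complexGaussian (fun _ => by positivity) hw
  set ε : Ω → n → ℂ := fun ω => h ω - lmmse A σ θ *ᵥ (A *ᵥ h ω + w ω) with hε
  set ψ : (m → ℂ) → κ → ℂ := fun v => U *ᵥ (lmmse A σ θ *ᵥ v) - f v with hψ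
  have hεL : ∀ a, MemLp (fun ω => ε ω a) 2 μ := memLp_two_lmmse_error A (lmmse A σ θ) hhL hwL
  have hUε : ∀ k, MemLp (fun ω => (U *ᵥ ε ω) k) 2 μ := memLp_two_mulVec U hεL
  have hψm : ∀ k, Measurable fun v => ψ v k := fun k =>
    (Continuous.measurable (by fun_prop : Continuous fun v : m → ℂ =>
      (U *ᵥ (lmmse A σ θ *ᵥ v)) k)).sub (hf k)
  have hsplit : ∀ ω, U *ᵥ h ω - f (A *ᵥ h ω + w ω) = U *ᵥ ε ω + ψ (A *ᵥ h ω + w ω) := fun ω => by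
    simp only [hε, hψ, Matrix.mulVec_sub]
    abel
  -- Only the total error is assumed square integrable, not the estimator itself, so `ψ(y)` is
  -- handled as the difference of that error and `U ε`.
  have hδL : ∀ k, MemLp (fun ω => ψ (A *ᵥ h ω + w ω) k) 2 μ := fun k => by
    have := (he k).sub (hUε k)
    refine this.ae_eq (Filter.Eventually.of_forall fun ω => ?_)
    have := congrFun (hsplit ω) k
    simp only [Pi.sub_apply, Pi.add_apply] at this ⊢
    rw [this]
    ring
  have hcross : ∀ k l, ∫ ω, (U *ᵥ ε ω) k * star (ψ (A *ᵥ h ω + w ω) l) ∂μ = 0 := fun k l => by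
    have : ∀ ω, (U *ᵥ ε ω) k * star (ψ (A *ᵥ h ω + w ω) l) =
        ∑ a, U k a * (ε ω a * star (ψ (A *ᵥ h ω + w ω) l)) := fun ω => by
      rw [Matrix.mulVec, dotProduct, Finset.sum_mul]
      simp only [mul_assoc]
    simp only [this]
    rw [integral_finsetSum _ fun a _ => (integrable_mul_star (hεL a) (hδL l)).const_mul _]
    refine Finset.sum_eq_zero fun a _ => ?_
    rw [integral_const_mul, integral_lmmse_error_mul_star_comp A hσ hθ hh hw hindep (hψm l) a,
      mul_zero]
  simp only [hsplit]
  rw [mseMatrix_add hUε hδL hcross, mseMatrix_mulVec U hεL,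
    mseMatrix_lmmse A hσ hθ hh hw hindep, add_sub_cancel_left]
  exact mseMatrix_posSemidef hδL

end model
end mse

/-! ### Linearity of the channel and the theorem -/

lemma effectiveChannel_vec {ι : Type*} [Fintype ι] (M : ℕ) (fL B T : ℝ)
    (G : Matrix (Fin M) (Fin M) ℂ) (τ α : ι → ℝ) (g : ι → ℂ) :
    (effectiveChannel M fL B T G τ α g).vec = channelJacobian M fL B T G τ α *ᵥ g := by
  ext ij
  simp only [effectiveChannel, timeChannel, Matrix.mul_sum, Matrix.sum_mul, Matrix.mul_smul,
    Matrix.smul_mul, Matrix.vec_sum, Matrix.vec_smul, Finset.sum_apply, Pi.smul_apply,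
    smul_eq_mul, Matrix.mulVec, dotProduct, channelJacobian, Matrix.of_apply]
  exact Finset.sum_congr rfl fun l _ => mul_comm _ _

theorem theorem1
    -- dimensions, band, durations, waveform and pilot data, grid
    (Md Mp Nτ Mα : ℕ) (fL B Ts Tp : ℝ)
    (G : Matrix (Fin Md) (Fin Md) ℂ) (Gp : Matrix (Fin Mp) (Fin Mp) ℂ) (xp : Fin Mp → ℂ)
    (qα : ℝ) (hqα : 0 < qα) (τ ωg : Fin (Nτ * Mα) → ℝ)
    (A : Matrix (Fin Mp) (Fin (Nτ * Mα)) ℂ)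
    (hA : A = measurementMatrix Mp fL B Tp Gp xp τ (scaleGrid qα ωg))
    (U : Matrix (Fin Md × Fin Md) (Fin (Nτ * Mα)) ℂ)
    (hU : U = channelJacobian Md fL B Ts G τ (scaleGrid qα ωg))
    -- prior precisions and noise standard deviation
    (θ : Fin (Nτ * Mα) → ℝ) (hθ : ∀ l, 0 < θ l) (σp : ℝ) (hσp : 0 < σp)
    -- the random model
    {Ω : Type*} [MeasurableSpace Ω] (μ : Measure Ω) [IsProbabilityMeasure μ]
    (h : Ω → Fin (Nτ * Mα) → ℂ) (w y : Ω → Fin Mp → ℂ)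
    (hh : HasLaw h (complexGaussian 0 (Matrix.diagonal fun l => (θ l : ℂ))⁻¹) μ)
    (hw : HasLaw w
      (complexGaussian 0 (((σp ^ 2 : ℝ) : ℂ) • (1 : Matrix (Fin Mp) (Fin Mp) ℂ))) μ)
    (hindep : IndepFun h w μ)
    (hy : ∀ ω, y ω = A *ᵥ h ω + w ω) :
    -- the information matrices
    realBIM μ A σp θ y h = realInfo A σp θ ∧
    complexBIM μ A σp θ y h = complexInfo A σp θ ∧
    (complexInfo A σp θ).PosDef ∧
    -- the channel is linear in the sparse vector
    (∀ g : Fin (Nτ * Mα) → ℂ,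
      (effectiveChannel Md fL B Ts G τ (scaleGrid qα ωg) g).vec = U *ᵥ g) ∧
    -- the bound, for every estimator with finite mean square error
    (∀ Hhat : (Fin Mp → ℂ) → Matrix (Fin Md) (Fin Md) ℂ,
      (∀ i j, Measurable fun v => Hhat v i j) →
      (∀ i j, MemLp (fun ω =>
        effectiveChannel Md fL B Ts G τ (scaleGrid qα ωg) (h ω) i j - Hhat (y ω) i j) 2 μ) →
      (mseMatrix μ (fun ω =>
          (effectiveChannel Md fL B Ts G τ (scaleGrid qα ωg) (h ω)).vec - (Hhat (y ω)).vec)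
        - U * (complexInfo A σp θ)⁻¹ * Uᴴ).PosSemidef) := by
  subst hA hU
  rw [smul_one_eq_inv_diagonal _ (by exact_mod_cast (pow_pos hσp 2).ne'),
    ← Complex.ofReal_inv] at hw
  obtain rfl : y = fun ω => _ := funext hy
  refine ⟨realBIM_eq μ _ hσp hθ _ h, complexBIM_eq μ _ hσp hθ _ h, complexInfo_posDef _ σp hθ,
    effectiveChannel_vec Md fL B Ts G τ _, fun Hhat hHm hHL => ?_⟩
  simp only [effectiveChannel_vec]
  refine mseMatrix_sub_posSemidef _ hσp hθ hh hw hindep _ (f := fun v => (Hhat v).vec)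
    -- `vec` stacks columns, so its index is (column, row) and the components are swapped.
    (fun k => hHm k.2 k.1) fun k => ?_
  simp only [← effectiveChannel_vec]
  exact hHL k.2 k.1
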